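/- **Theorem 4.2.** Let $\Gamma\subseteq\mathrm{PSL}_2(\mathbb{R})$ be a Fuchsian group (a discrete subgroup), acting on the upper half-plane $\mathbb{H}=\{z=x+iy : y>0\}$ by fractional linear transformations, and let $M=\Gamma\backslash\mathbb{H}$ be the quotient space. For an integer $k\ge 1$, let $\mathcal{S}_{2k}^{\Gamma}$ be the space of cusp forms of weight $2k$ for $\Gamma$, i.e. of holomorphic functions $f:\mathbb{H}\to\mathbb{C}$ with $f(\gamma z)=(cz+d)^{2k}f(z)$ for all $\gamma=\pm\begin{pmatrix}a&b\\c&d\end{pmatrix}\in\Gamma$ that vanish at all cusps of $\Gamma$, which have finite norm with respect to the Petersson inner product $$\langle f,g\rangle=\int_M f(z)\,\overline{g(z)}\,y^{2k}\,\frac{dx\,dy}{y^2}.$$ (If $\Gamma$ is of the first kind, i.e. if $M$ has finite hyperbolic area, all cusp forms have finite norm and $\mathcal{S}_{2k}^{\Gamma}$ is finite-dimensional.) Let $(f_j)_j$ be an orthonormal basis of the Hilbert space $\mathcal{S}_{2k}^{\Gamma}$ and put $$S_k^{\Gamma}(z)=\sum_j|f_j(z)|^2\,y^{2k},$$ a $\Gamma$-invariant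 function of $z\in\mathbb{H}$ and hence a function on $M$. Then for every Fuchsian group $\Gamma$ and every compact subset $K\subseteq M$ there is a constant $C\ge 0$, depending only on $\Gamma$ and $K$, such that for all integers $k\ge 1$ $$\sup_{z\in K}S_k^{\Gamma}(z)\le C\,k .$$ -/

import Mathlib

open MeasureTheory UpperHalfPlane
open scoped MatrixGroups Pointwise Topology NNReal ENNReal ComplexConjugate

namespace Fuchsian

/-- The action of `PSL(2, ℝ)` on the upper half-plane by fractional linear transformations, as a
homomorphism to permutations of `ℍ`; it is induced by the action of `SL(2, ℝ)`. -/
noncomputable def toPermHom : PSL(2, ℝ) →* Equiv.Perm ℍ :=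
  QuotientGroup.lift (Subgroup.center SL(2, ℝ)) (MulAction.toPermHom SL(2, ℝ) ℍ) (by
    intro g hg
    ext z : 1
    obtain ⟨r, hr, hg⟩ := Matrix.SpecialLinearGroup.mem_center_iff.mp hg
    have hr0 : (r : ℂ) ≠ 0 := by
      rintro h
      simp only [Complex.ofReal_eq_zero] at h
      simp [h] at hr
    have h00 : g 0 0 = r := by rw [← hg]; simp
    have h01 : g 0 1 = 0 := by rw [← hg]; simp
    have h10 : g 1 0 = 0 := by rw [← hg]; simp
    have h11 : g 1 1 = r := by rw [← hg]; simp
    change g • z = z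
    ext
    rw [coe_specialLinearGroup_apply, h00, h01, h10, h11]
    simp [hr0])

/-- `PSL(2, ℝ)` acts on the upper half-plane by fractional linear transformations. -/
noncomputable instance : MulAction PSL(2, ℝ) ℍ := MulAction.compHom ℍ toPermHom

theorem mk_smul (g : SL(2, ℝ)) (z : ℍ) : (QuotientGroup.mk g : PSL(2, ℝ)) • z = g • z := rfl

/-- The quotient space `M = Γ \ ℍ`, with the quotient topology. -/
abbrev QuotientSpace (Γ : Subgroup PSL(2, ℝ)) : Type := Quotient (MulAction.orbitRel Γ ℍ)

/-- The group of all real matrices of determinant one that represent an element of `Γ`. -/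
noncomputable abbrev matrixGroup (Γ : Subgroup PSL(2, ℝ)) : Subgroup (GL (Fin 2) ℝ) :=
  (Γ.comap (QuotientGroup.mk' (Subgroup.center SL(2, ℝ)))).map
    (Matrix.SpecialLinearGroup.mapGL ℝ)

/-- A discrete subgroup of `PSL(2, ℝ)` has a discrete preimage in `SL(2, ℝ)`. -/
theorem discreteTopology_comap (Γ : Subgroup PSL(2, ℝ)) [DiscreteTopology Γ] :
    DiscreteTopology (Γ.comap (QuotientGroup.mk' (Subgroup.center SL(2, ℝ)))) := by
  have : Finite (Subgroup.center SL(2, ℝ)) :=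
    Finite.of_equiv _ (Matrix.SpecialLinearGroup.center_equiv_rootsOfUnity'
      (R := ℝ) (0 : Fin 2)).symm.toEquiv
  have hfin : (Subgroup.center SL(2, ℝ) : Set SL(2, ℝ)).Finite := Set.toFinite _
  obtain ⟨U, hU, hU1⟩ := isOpen_induced_iff.mp (isOpen_discrete ({1} : Set Γ))
  refine discreteTopology_of_isOpen_singleton_one (isOpen_induced_iff.mpr
    ⟨(QuotientGroup.mk ⁻¹' U) ∩ ((Subgroup.center SL(2, ℝ) : Set SL(2, ℝ)) \ {1})ᶜ,
      (hU.preimage QuotientGroup.continuous_mk).inter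
        (hfin.subset Set.sdiff_subset).isClosed.isOpen_compl, ?_⟩)
  ext ⟨g, hg⟩
  have key : (QuotientGroup.mk g : PSL(2, ℝ)) ∈ U ↔ g ∈ Subgroup.center SL(2, ℝ) := by
    have := Set.ext_iff.mp hU1 ⟨QuotientGroup.mk g, hg⟩
    simp only [Set.mem_preimage, Set.mem_singleton_iff, Subtype.ext_iff] at this
    rw [this]
    exact QuotientGroup.eq_one_iff g
  simp only [Set.mem_preimage, Set.mem_inter_iff, key, Set.mem_compl_iff, Set.mem_sdiff,
    Set.mem_singleton_iff, SetLike.mem_coe, Subtype.ext_iff, OneMemClass.coe_one]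
  constructor
  · tauto
  · rintro rfl
    exact ⟨one_mem _, by simp⟩

theorem exists_representative (Γ : Subgroup PSL(2, ℝ)) (γ : Γ) :
    ∃ g : Γ.comap (QuotientGroup.mk' (Subgroup.center SL(2, ℝ))),
      (QuotientGroup.mk (g : SL(2, ℝ)) : PSL(2, ℝ)) = γ := by
  obtain ⟨g, hg⟩ := QuotientGroup.mk_surjective (γ : PSL(2, ℝ))
  exact ⟨⟨g, show (QuotientGroup.mk g : PSL(2, ℝ)) ∈ Γ from hg ▸ γ.2⟩, hg⟩

theorem countable_of_discrete (Γ : Subgroup PSL(2, ℝ)) [DiscreteTopology Γ] : Countable Γ := by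
  have := discreteTopology_comap Γ
  have : SecondCountableTopology (Matrix (Fin 2) (Fin 2) ℝ) :=
    inferInstanceAs (SecondCountableTopology (Fin 2 → Fin 2 → ℝ))
  have : SecondCountableTopology SL(2, ℝ) :=
    Matrix.SpecialLinearGroup.isClosedEmbedding_val.isEmbedding.secondCountableTopology
  have : Countable (Γ.comap (QuotientGroup.mk' (Subgroup.center SL(2, ℝ)))) :=
    TopologicalSpace.separableSpace_iff_countable.mp inferInstance
  choose s hs using exists_representative Γ
  refine Function.Injective.countable (f := s) fun a b h => Subtype.ext ?_
  rw [← hs a, ← hs b, h]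

instance (Γ : Subgroup PSL(2, ℝ)) : ContinuousConstSMul Γ ℍ where
  continuous_const_smul γ := by
    obtain ⟨g, hg⟩ := exists_representative Γ γ
    have : (fun z : ℍ => γ • z) = fun z => (g : SL(2, ℝ)) • z := by
      ext1 z
      rw [Subgroup.smul_def, ← hg, mk_smul]
    rw [this]
    exact continuous_const_smul _

instance (Γ : Subgroup PSL(2, ℝ)) : SMulInvariantMeasure Γ ℍ volume where
  measure_preimage_smul γ s hs := by
    obtain ⟨g, hg⟩ := exists_representative Γ γ
    have : (fun z : ℍ => γ • z) =
        fun z => (Matrix.SpecialLinearGroup.mapGL ℝ (g : SL(2, ℝ)) : GL (Fin 2) ℝ) • z := by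
      ext1 z
      rw [Subgroup.smul_def, ← hg, mk_smul]
      rfl
    rw [this]
    exact measure_preimage_smul_of_nullMeasurableSet hs.nullMeasurableSet _

/-- A Fuchsian group acts properly discontinuously on the upper half-plane. -/
instance (Γ : Subgroup PSL(2, ℝ)) [DiscreteTopology Γ] : ProperlyDiscontinuousSMul Γ ℍ where
  finite_disjoint_inter_image {K L} hK hL := by
    have := discreteTopology_comap Γ
    have hfin := ProperlyDiscontinuousSMul.finite_disjoint_inter_image
      (Γ := Γ.comap (QuotientGroup.mk' (Subgroup.center SL(2, ℝ)))) hK hL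
    choose s hs using exists_representative Γ
    refine Set.Finite.of_finite_image (f := s) (hfin.subset ?_) ?_
    · rintro _ ⟨γ, ⟨_, ⟨z, hz, rfl⟩, hzL⟩, rfl⟩
      refine ⟨γ • z, ⟨z, hz, ?_⟩, hzL⟩
      change (s γ : SL(2, ℝ)) • z = γ • z
      rw [Subgroup.smul_def, ← hs γ, mk_smul]
    · intro a _ b _ h
      exact Subtype.ext (by rw [← hs a, ← hs b, h])

/-- A nontrivial element of `PSL(2, ℝ)` fixes at most one point of `ℍ`. -/
theorem fixed_subsingleton (γ : PSL(2, ℝ)) (hγ : γ ≠ 1) : {z : ℍ | γ • z = z}.Subsingleton := by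
  obtain ⟨g, rfl⟩ := QuotientGroup.mk_surjective γ
  intro z hz w hw
  set h : GL (Fin 2) ℝ := Matrix.SpecialLinearGroup.mapGL ℝ g with hh
  have hz' : h • z = z := hz
  have hw' : h • w = w := hw
  have hpos : 0 < h.val.det := by simp [hh]
  have hc : h ∉ Subgroup.center (GL (Fin 2) ℝ) := by
    intro hc
    refine hγ ((QuotientGroup.eq_one_iff g).mpr (Subgroup.mem_center_iff.mpr fun k => ?_))
    apply Matrix.SpecialLinearGroup.mapGL_injective (S := ℝ)
    rw [map_mul, map_mul]
    exact Subgroup.mem_center_iff.mp hc _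
  have hell := isElliptic_of_exists_smul_eq_self hpos hc ⟨z, hz'⟩
  rw [(gl_smul_eq_self_iff_eq_fixedPt hpos hell).mp hz',
    (gl_smul_eq_self_iff_eq_fixedPt hpos hell).mp hw']

theorem volume_of_subsingleton {s : Set ℍ} (hs : s.Subsingleton) : volume s = 0 := by
  rw [volume_eq_lintegral]
  exact setLIntegral_measure_zero _ _ ((hs.image _).measure_zero _)

/-- Every Fuchsian group has a fundamental domain in the upper half-plane. -/
theorem exists_isFundamentalDomain (Γ : Subgroup PSL(2, ℝ)) [DiscreteTopology Γ] :
    ∃ F : Set ℍ, IsFundamentalDomain Γ F volume := by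
  have := countable_of_discrete Γ
  have hU : ∀ z : ℍ, ∃ U : Set ℍ, IsOpen U ∧ z ∈ U ∧
      ∀ γ : Γ, γ • z ≠ z → Disjoint ((γ • ·) '' U) U := by
    intro z
    obtain ⟨V, hV, hd⟩ := ProperlyDiscontinuousSMul.exists_nhds_disjoint_image Γ z
    obtain ⟨U, hUV, hUo, hzU⟩ := mem_nhds_iff.mp hV
    exact ⟨U, hUo, hzU, fun γ hγ => (hd γ hγ).mono (Set.image_mono hUV) hUV⟩
  choose U hUo hzU hUd using hU
  set E : Set ℍ := ⋃ γ : {γ : Γ // γ ≠ 1}, {z : ℍ | (γ : Γ) • z = z} with hE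
  have hE0 : volume E = 0 := measure_iUnion_null fun γ => volume_of_subsingleton
    (fixed_subsingleton _ fun h => γ.2 (Subtype.ext h))
  obtain ⟨T, hTE, hTc, hT⟩ := TopologicalSpace.countable_cover_nhdsWithin (s := Eᶜ)
    (f := U) (fun z _ => mem_nhdsWithin_of_mem_nhds ((hUo z).mem_nhds (hzU z)))
  have := hTc.to_subtype
  obtain ⟨e, he⟩ := exists_injective_nat T
  -- the points of `U t` whose orbit does not meet an earlier set of the cover
  let A : T → Set ℍ := fun t => U t \ ⋃ s : {s : T // e s < e t}, ⋃ γ : Γ, (γ • ·) ⁻¹' U s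
  have hA : ∀ t, MeasurableSet (A t) := fun t =>
    (hUo t).measurableSet.diff (MeasurableSet.iUnion fun s => MeasurableSet.iUnion fun γ =>
      ((hUo s).preimage (continuous_const_smul γ)).measurableSet)
  refine ⟨⋃ t, A t, IsFundamentalDomain.mk'' (MeasurableSet.iUnion hA).nullMeasurableSet ?_ ?_
    fun γ => (measurePreserving_smul γ volume).quasiMeasurePreserving⟩
  · filter_upwards [compl_mem_ae_iff.mpr hE0] with z hz
    have hex : ∃ n, ∃ t : T, e t = n ∧ ∃ γ : Γ, γ • z ∈ U t := by
      obtain ⟨t, ht, hzt⟩ := Set.mem_iUnion₂.mp (hT hz)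
      exact ⟨_, ⟨t, ht⟩, rfl, 1, by simpa using hzt⟩
    classical
    obtain ⟨t, ht, γ, hγ⟩ := Nat.find_spec hex
    refine ⟨γ, Set.mem_iUnion.mpr ⟨t, hγ, fun hmem => ?_⟩⟩
    simp only [Set.mem_iUnion, Set.mem_preimage] at hmem
    obtain ⟨⟨s, hs⟩, δ, hδ⟩ := hmem
    exact Nat.find_min hex (ht ▸ hs) ⟨s, rfl, δ * γ, by rwa [mul_smul]⟩
  · intro γ hγ
    refine Disjoint.aedisjoint (Set.disjoint_left.mpr ?_)
    rintro _ ⟨z, hz, rfl⟩ hγz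
    obtain ⟨t, hzt, hzt'⟩ := Set.mem_iUnion.mp hz
    obtain ⟨s, hzs, hzs'⟩ := Set.mem_iUnion.mp hγz
    simp only [Set.mem_iUnion, Set.mem_preimage, not_exists] at hzt' hzs'
    have hst : s = t := by
      apply he
      apply le_antisymm
      · by_contra! h
        exact hzs' ⟨t, h⟩ γ⁻¹ (by simpa using hzt)
      · by_contra! h
        exact hzt' ⟨s, h⟩ γ hzs
    subst hst
    have hne : γ • (s : ℍ) ≠ s := fun h =>
      hTE s.2 (Set.mem_iUnion.mpr ⟨⟨γ, hγ⟩, h⟩)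
    exact Set.disjoint_left.mp (hUd _ γ hne) ⟨z, hzt, rfl⟩ hzs

/-- A fundamental domain of a Fuchsian group. Integrals over `M = Γ \ ℍ` are integrals over it;
they do not depend on the choice. -/
noncomputable def fundamentalDomain (Γ : Subgroup PSL(2, ℝ)) [DiscreteTopology Γ] : Set ℍ :=
  (exists_isFundamentalDomain Γ).choose

theorem isFundamentalDomain (Γ : Subgroup PSL(2, ℝ)) [DiscreteTopology Γ] :
    IsFundamentalDomain Γ (fundamentalDomain Γ) volume :=
  (exists_isFundamentalDomain Γ).choose_spec

/-- The space of cusp forms of weight `2k` for `Γ`: holomorphic functions `f` on `ℍ` with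
`f (γ z) = (c z + d) ^ (2k) * f z` for `γ ∈ Γ` which vanish at all cusps of `Γ`. -/
abbrev CuspForms (Γ : Subgroup PSL(2, ℝ)) (k : ℕ) : Type := CuspForm (matrixGroup Γ) (2 * k)

section Petersson

variable {Γ : Subgroup PSL(2, ℝ)} {k : ℕ}

/-- The function `|f(z)|² Im(z)^(2k)` is invariant under `Γ`. -/
theorem sq_norm_mul_im_smul (f : CuspForms Γ k) (γ : Γ) (z : ℍ) :
    ‖f (γ • z)‖ ^ 2 * (γ • z).im ^ (2 * k) = ‖f z‖ ^ 2 * z.im ^ (2 * k) := by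
  obtain ⟨g, hg⟩ := exists_representative Γ γ
  have h := SlashInvariantFormClass.norm_petersson_smul (k := 2 * (k : ℤ)) (f := f) (f' := f)
    (τ := z) (Subgroup.mem_map_of_mem (Matrix.SpecialLinearGroup.mapGL ℝ) g.2)
  have hs : (Matrix.SpecialLinearGroup.mapGL ℝ (g : SL(2, ℝ)) : GL (Fin 2) ℝ) • z = γ • z := by
    rw [Subgroup.smul_def, ← hg, mk_smul]
    rfl
  have hp : ∀ w : ℍ, ‖petersson (2 * (k : ℤ)) f f w‖ = ‖f w‖ ^ 2 * w.im ^ (2 * k) := by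
    intro w
    have : (w.im : ℂ) ^ (2 * (k : ℤ)) = (w.im : ℂ) ^ (2 * k) := by
      rw [← zpow_natCast]
      push_cast
      rfl
    rw [petersson, this]
    simp [sq, abs_of_pos w.im_pos]
  rwa [hs, hp, hp] at h

/-- The Petersson inner product `⟨f, g⟩ = ∫_M f(z) conj(g(z)) y^(2k) dμ(z)` with respect to the
hyperbolic measure `dμ = dx dy / y²`, which is the volume on `ℍ`. -/
noncomputable def peterssonInner [DiscreteTopology Γ] (f g : CuspForms Γ k) : ℂ :=
  ∫ z in fundamentalDomain Γ, f z * conj (g z) * (z.im : ℂ) ^ (2 * k)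

/-- The cusp form `f` has finite Petersson norm. -/
def SquareIntegrable [DiscreteTopology Γ] (f : CuspForms Γ k) : Prop :=
  IntegrableOn (fun z : ℍ => ‖f z‖ ^ 2 * z.im ^ (2 * k)) (fundamentalDomain Γ)

/-- The family `f` is an orthonormal basis of the Hilbert space of cusp forms of weight `2k` of
finite Petersson norm: it is orthonormal, and only `0` is orthogonal to all its members. -/
structure IsOrthonormalBasis [DiscreteTopology Γ] {ι : Type*} (f : ι → CuspForms Γ k) : Prop where
  squareIntegrable : ∀ j, SquareIntegrable (f j)
  inner_self : ∀ j, peterssonInner (f j) (f j) = 1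
  inner_of_ne : ∀ i j, i ≠ j → peterssonInner (f i) (f j) = 0
  total : ∀ g : CuspForms Γ k, SquareIntegrable g → (∀ j, peterssonInner g (f j) = 0) → g = 0

/-- The function `S(z) = ∑ⱼ |fⱼ(z)|² Im(z)^(2k)` on `M = Γ \ ℍ`, with values in `[0, ∞]`. -/
noncomputable def sumSq {ι : Type*} (f : ι → CuspForms Γ k) : QuotientSpace Γ → ℝ≥0∞ :=
  Quotient.lift (fun z : ℍ => ∑' j, ENNReal.ofReal (‖f j z‖ ^ 2 * z.im ^ (2 * k))) (by
    rintro _ z ⟨γ, rfl⟩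
    exact tsum_congr fun j => congrArg ENNReal.ofReal (sq_norm_mul_im_smul (f j) γ z))

end Petersson

end Fuchsian

/-!
Let `u_j = y ^ k f_j`. The Petersson product is the `L²` product of these functions over a
fundamental domain, so a point evaluation estimate `|u(w)|² ≤ B ‖u‖²`, valid for all `u` in the span
of the `u_j`, gives `∑ |u_j(w)|² ≤ B`: apply it to `u = ∑ conj (u_j(w)) u_j`.

Such an estimate with `B` linear in `k` is local. The holomorphic function
`((z - conj w) / (2 i Im w)) ^ (4k) f(z) ^ 2 (Im w) ^ (2k)` has absolute value
`cosh (d(z, w) / 2) ^ (4k) |u(z)|²`, and the first factor is bounded on the disc of hyperbolic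
radius `~ k ^ (-1/2)` around `w`, whose area is of order `1 / k`; the mean value property on that
disc bounds `|u(w)|²` by `O(k)` times the integral of `|u|²` over the disc. For `w` in a compact
set, all these discs lie in a compact set, and a compact set is covered by the fundamental domain
with bounded multiplicity.
-/

open scoped Manifold

namespace Fuchsian

section Topology

theorem exists_isCompact_subset_image {X Y : Type*} [TopologicalSpace X] [TopologicalSpace Y]
    [WeaklyLocallyCompactSpace X] {f : X → Y} (hf : IsOpenQuotientMap f) {K : Set Y}
    (hK : IsCompact K) : ∃ A : Set X, IsCompact A ∧ K ⊆ f '' A := by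
  choose A hA hAx using fun x : X => exists_compact_mem_nhds x
  obtain ⟨t, ht⟩ := hK.elim_finite_subcover (fun x => f '' interior (A x))
    (fun x => hf.isOpenMap _ isOpen_interior) fun y _ => by
      obtain ⟨x, rfl⟩ := hf.surjective y
      exact Set.mem_iUnion.mpr ⟨x, x, mem_interior_iff_mem_nhds.mpr (hAx x), rfl⟩
  refine ⟨⋃ x ∈ t, A x, t.isCompact_biUnion fun x _ => hA x, ht.trans ?_⟩
  simp only [Set.image_iUnion]
  gcongr
  exact interior_subset

end Topology

section Unfolding

variable {G α : Type*} [Group G] [MulAction G α]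

theorem exists_encard_mem_smul_le [TopologicalSpace α] [ProperlyDiscontinuousSMul G α] {L : Set α}
    (hL : IsCompact L) : ∃ N : ℕ, ∀ x, {g : G | x ∈ g • L}.encard ≤ N := by
  have hfin : {g : G | ((g • ·) '' L ∩ L).Nonempty}.Finite :=
    ProperlyDiscontinuousSMul.finite_disjoint_inter_image hL hL
  refine ⟨_, fun x => le_of_le_of_eq ?_ hfin.encard_eq_coe_toFinset_card⟩
  obtain h | ⟨h, hx⟩ := {g : G | x ∈ g • L}.eq_empty_or_nonempty
  · simp [h]
  · refine Set.encard_le_encard_of_injOn (f := (h⁻¹ * ·)) (fun g hg => ?_)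
      (mul_right_injective _).injOn
    exact ⟨h⁻¹ • x, ⟨g⁻¹ • x, Set.mem_smul_set_iff_inv_smul_mem.mp hg, by simp [mul_smul]⟩,
      Set.mem_smul_set_iff_inv_smul_mem.mp hx⟩

theorem setLIntegral_le_of_encard_mem_smul_le [MeasurableSpace α] [Countable G]
    [MeasurableConstSMul G α] {μ : Measure α} [SMulInvariantMeasure G α μ] {D L : Set α}
    (hD : IsFundamentalDomain G D μ) (hL : MeasurableSet L) {N : ℕ∞}
    (hN : ∀ x, {g : G | x ∈ g • L}.encard ≤ N) {φ : α → ℝ≥0∞} (hφ : AEMeasurable φ μ)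
    (hinv : ∀ (g : G) (x : α), φ (g • x) = φ x) :
    ∫⁻ x in L, φ x ∂μ ≤ N * ∫⁻ x in D, φ x ∂μ := by
  have hmeas (g : G) : MeasurableSet (g • L) := hL.const_smul g
  calc ∫⁻ x in L, φ x ∂μ
      = ∑' g : G, ∫⁻ x in g • L ∩ D, φ x ∂μ := by
        simp_rw [hD.setLIntegral_eq_tsum' φ L, hinv]
    _ = ∑' g : G, ∫⁻ x in D, (g • L).indicator φ x ∂μ := by
        simp_rw [lintegral_indicator (hmeas _), Measure.restrict_restrict (hmeas _)]
    _ = ∫⁻ x in D, ∑' g : G, (g • L).indicator φ x ∂μ :=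
        (lintegral_tsum fun g => (hφ.indicator (hmeas g)).restrict).symm
    _ = ∫⁻ x in D, {g : G | x ∈ g • L}.encard * φ x ∂μ := by
        refine lintegral_congr fun x => ?_
        rw [← ENNReal.tsum_set_const, tsum_subtype _ fun _ => φ x]
        rfl
    _ ≤ ∫⁻ x in D, N * φ x ∂μ := by
        gcongr with x
        exact_mod_cast hN x
    _ = N * ∫⁻ x in D, φ x ∂μ := lintegral_const_mul'' _ hφ.restrict

theorem exists_setLIntegral_le_fundamentalDomain [TopologicalSpace α] [T2Space α]
    [MeasurableSpace α] [OpensMeasurableSpace α] [Countable G] [MeasurableConstSMul G α]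
    [ProperlyDiscontinuousSMul G α] {μ : Measure α} [SMulInvariantMeasure G α μ] {D L : Set α}
    (hD : IsFundamentalDomain G D μ) (hL : IsCompact L) :
    ∃ N : ℕ, ∀ φ : α → ℝ≥0∞, AEMeasurable φ μ → (∀ (g : G) (x : α), φ (g • x) = φ x) →
      ∫⁻ x in L, φ x ∂μ ≤ N * ∫⁻ x in D, φ x ∂μ := by
  obtain ⟨N, hN⟩ := exists_encard_mem_smul_le (G := G) hL
  exact ⟨N, fun φ hφ hinv => by
    simpa using setLIntegral_le_of_encard_mem_smul_le hD hL.measurableSet hN hφ hinv⟩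

end Unfolding

section Bessel

variable {α ι 𝕜 : Type*} [RCLike 𝕜] [MeasurableSpace α] {μ : Measure α} {u : ι → α → 𝕜}

theorem norm_sq_sum_smul_of_orthonormal {E : Type*} [SeminormedAddCommGroup E]
    [InnerProductSpace 𝕜 E] {v : ι → E} (hv : Orthonormal 𝕜 v) (t : Finset ι) (a : ι → 𝕜) :
    ‖∑ j ∈ t, a j • v j‖ ^ 2 = ∑ j ∈ t, ‖a j‖ ^ 2 := by
  rw [← RCLike.ofReal_inj (K := 𝕜), RCLike.ofReal_pow, ← inner_self_eq_norm_sq_to_K,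
    hv.inner_sum]
  push_cast
  exact Finset.sum_congr rfl fun j _ => RCLike.conj_mul _

theorem lintegral_enorm_sq_sum_of_orthonormal (hu : ∀ j, MemLp (u j) 2 μ)
    (horth : Orthonormal 𝕜 fun j => (hu j).toLp) (t : Finset ι) (a : ι → 𝕜) :
    ∫⁻ x, ‖∑ j ∈ t, a j * u j x‖ₑ ^ 2 ∂μ = ∑ j ∈ t, ‖a j‖ₑ ^ 2 := by
  have hcoe : ⇑(∑ j ∈ t, a j • (hu j).toLp) =ᵐ[μ] fun x => ∑ j ∈ t, a j * u j x := by
    refine (Lp.coeFn_fun_finsetSum t _).trans ?_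
    have h (j : ι) : ⇑(a j • (hu j).toLp) =ᵐ[μ] fun x => a j * u j x :=
      (Lp.coeFn_smul _ _).trans ((hu j).coeFn_toLp.const_smul (a j))
    filter_upwards [(ae_ball_iff t.countable_toSet).mpr fun j _ => h j] with x hx
    exact Finset.sum_congr rfl hx
  calc ∫⁻ x, ‖∑ j ∈ t, a j * u j x‖ₑ ^ 2 ∂μ
      = ∫⁻ x, ‖(∑ j ∈ t, a j • (hu j).toLp : Lp 𝕜 2 μ) x‖ₑ ^ 2 ∂μ :=
        lintegral_congr_ae <| hcoe.mono fun x hx => by simp only [hx]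
    _ = ‖∑ j ∈ t, a j • (hu j).toLp‖ₑ ^ 2 := by
        have := eLpNorm_nnreal_pow_eq_lintegral (μ := μ) (p := 2)
          (f := (∑ j ∈ t, a j • (hu j).toLp : Lp 𝕜 2 μ)) two_ne_zero
        rw [Lp.enorm_def]
        simpa using this.symm
    _ = ∑ j ∈ t, ‖a j‖ₑ ^ 2 := by
        simp_rw [← ofReal_norm, ← ENNReal.ofReal_pow (norm_nonneg _),
          norm_sq_sum_smul_of_orthonormal horth]
        exact ENNReal.ofReal_sum_of_nonneg fun j _ => sq_nonneg _

theorem tsum_enorm_sq_le_of_orthonormal (hu : ∀ j, MemLp (u j) 2 μ)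
    (horth : Orthonormal 𝕜 fun j => (hu j).toLp) {x : α} {B : ℝ≥0∞}
    (hB : ∀ (t : Finset ι) (a : ι → 𝕜),
      ‖∑ j ∈ t, a j * u j x‖ₑ ^ 2 ≤ B * ∫⁻ y, ‖∑ j ∈ t, a j * u j y‖ₑ ^ 2 ∂μ) :
    ∑' j, ‖u j x‖ₑ ^ 2 ≤ B := by
  rw [ENNReal.tsum_eq_iSup_sum]
  refine iSup_le fun t => ?_
  set s : ℝ≥0∞ := ∑ j ∈ t, ‖u j x‖ₑ ^ 2 with hs
  have hsum : ‖∑ j ∈ t, conj (u j x) * u j x‖ₑ = s := by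
    have : ∑ j ∈ t, conj (u j x) * u j x = ((∑ j ∈ t, ‖u j x‖ ^ 2 : ℝ) : 𝕜) := by
      simp_rw [RCLike.conj_mul]
      push_cast
      rfl
    rw [this, ← ofReal_norm, RCLike.norm_ofReal,
      abs_of_nonneg (Finset.sum_nonneg fun j _ => sq_nonneg _),
      ENNReal.ofReal_sum_of_nonneg fun j _ => sq_nonneg _]
    simp_rw [hs, ENNReal.ofReal_pow (norm_nonneg _), ofReal_norm]
  have hle : s * s ≤ B * s := by
    have := hB t fun j => conj (u j x)
    rw [lintegral_enorm_sq_sum_of_orthonormal hu horth, hsum, sq] at this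
    simpa [hs] using this
  have hs_top : s ≠ ⊤ := ENNReal.sum_ne_top.mpr fun j _ => ENNReal.pow_ne_top enorm_ne_top
  obtain h0 | h0 := eq_or_ne s 0
  · simp [h0]
  · exact (ENNReal.mul_le_mul_iff_left h0 hs_top).mp hle

end Bessel

section SubMeanValue

variable {E : Type*} [NormedAddCommGroup E] [NormedSpace ℂ E] [CompleteSpace E]
  {f : ℂ → E} {c : ℂ} {R : ℝ}

theorem enorm_mul_two_pi_le_lintegral_circleMap
    (hf : DiffContOnCl ℂ f (Metric.ball c |R|)) :
    ‖f c‖ₑ * ENNReal.ofReal (2 * Real.pi) ≤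
      ∫⁻ θ in Set.Ioc 0 (2 * Real.pi), ‖f (circleMap c R θ)‖ₑ := by
  have hmean := hf.circleAverage
  rw [Real.circleAverage_def, inv_smul_eq_iff₀ Real.two_pi_pos.ne',
    intervalIntegral.integral_of_le Real.two_pi_pos.le] at hmean
  calc ‖f c‖ₑ * ENNReal.ofReal (2 * Real.pi) = ‖(2 * Real.pi) • f c‖ₑ := by
        rw [enorm_smul, Real.enorm_of_nonneg Real.two_pi_pos.le, mul_comm]
    _ ≤ _ := hmean ▸ enorm_integral_le_lintegral_enorm _

theorem lintegral_comp_add_circleMap_mul {φ : ℂ → ℝ≥0∞} (hφ : Measurable φ) (c : ℂ) (θ : ℝ) :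
    ∫⁻ w, φ (c + circleMap 0 1 θ * w) = ∫⁻ z, φ z := by
  have hrot : MeasurePreserving (fun w : ℂ => circleMap 0 1 θ * w) := by
    convert (rotation (Circle.exp θ)).measurePreserving using 2 with w
    simp [circleMap]
  rw [← lintegral_add_left_eq_self φ c]
  exact hrot.lintegral_comp (f := fun w => φ (c + w)) (by fun_prop)

theorem enorm_mul_two_pi_le_lintegral_rotation
    (hf : DifferentiableOn ℂ f (Metric.ball c R)) {w : ℂ} (hw : w ∈ Metric.ball (0 : ℂ) R) :
    ‖f c‖ₑ * ENNReal.ofReal (2 * Real.pi) ≤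
      ∫⁻ θ in Set.Ioc 0 (2 * Real.pi), ‖f (c + circleMap 0 1 θ * w)‖ₑ := by
  have hmaps : Set.MapsTo (c + · * w) (Metric.closedBall 0 1) (Metric.ball c R) := by
    intro z hz
    rw [mem_closedBall_zero_iff] at hz
    rw [mem_ball_zero_iff] at hw
    rw [Metric.mem_ball, dist_self_add_left, norm_mul]
    nlinarith [norm_nonneg w]
  have hd : DiffContOnCl ℂ (fun z => f (c + z * w)) (Metric.ball 0 |1|) := by
    rw [abs_one]
    exact DifferentiableOn.diffContOnCl_ball (hf.comp (by fun_prop) hmaps) le_rfl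
  simpa using enorm_mul_two_pi_le_lintegral_circleMap hd

theorem enorm_mul_volume_ball_le_lintegral
    (hf : DifferentiableOn ℂ f (Metric.ball c R)) :
    ‖f c‖ₑ * volume (Metric.ball c R) ≤ ∫⁻ z in Metric.ball c R, ‖f z‖ₑ := by
  classical
  set φ : ℂ → ℝ≥0∞ := (Metric.ball c R).indicator fun z => ‖f z‖ₑ with hφ
  have hφm : Measurable φ := by
    rw [hφ, ← Set.piecewise_eq_indicator]
    exact hf.continuousOn.enorm.measurable_piecewise continuousOn_const measurableSet_ball
  have h2pi : ENNReal.ofReal (2 * Real.pi) ≠ 0 := by simp [Real.pi_pos]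
  refine (ENNReal.mul_le_mul_iff_left h2pi ENNReal.ofReal_ne_top).mp ?_
  calc ‖f c‖ₑ * volume (Metric.ball c R) * ENNReal.ofReal (2 * Real.pi)
      = ∫⁻ _ in Metric.ball (0 : ℂ) R, ‖f c‖ₑ * ENNReal.ofReal (2 * Real.pi) := by
        rw [setLIntegral_const, Complex.volume_ball, Complex.volume_ball, mul_right_comm]
    _ ≤ ∫⁻ w in Metric.ball (0 : ℂ) R,
          ∫⁻ θ in Set.Ioc 0 (2 * Real.pi), φ (c + circleMap 0 1 θ * w) := by
        refine setLIntegral_mono' measurableSet_ball fun w hw => ?_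
        refine (enorm_mul_two_pi_le_lintegral_rotation hf hw).trans_eq
          (lintegral_congr fun θ => ?_)
        rw [hφ, Set.indicator_of_mem (by simpa using hw)]
    _ ≤ ∫⁻ w, ∫⁻ θ in Set.Ioc 0 (2 * Real.pi), φ (c + circleMap 0 1 θ * w) :=
        setLIntegral_le_lintegral _ _
    _ = ∫⁻ θ in Set.Ioc 0 (2 * Real.pi), ∫⁻ w, φ (c + circleMap 0 1 θ * w) := by
        have hcont : Continuous fun p : ℂ × ℝ => c + circleMap 0 1 p.2 * p.1 := by fun_prop
        exact lintegral_lintegral_swap (hφm.comp hcont.measurable).aemeasurable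
    _ = (∫⁻ z in Metric.ball c R, ‖f z‖ₑ) * ENNReal.ofReal (2 * Real.pi) := by
        simp_rw [lintegral_comp_add_circleMap_mul hφm]
        rw [setLIntegral_const, Real.volume_Ioc, sub_zero, hφ,
          lintegral_indicator measurableSet_ball]

end SubMeanValue

section LocalEstimate

theorem setLIntegral_eq_setLIntegral_preimage_coe (φ : ℂ → ℝ≥0∞) {s : Set ℂ} (hs : MeasurableSet s)
    (hpos : ∀ z ∈ s, 0 < z.im) :
    ∫⁻ z in s, φ z = ∫⁻ z in ((↑) : ℍ → ℂ) ⁻¹' s, ENNReal.ofReal (z.im ^ 2) * φ z := by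
  have himg : ((↑) : ℍ → ℂ) '' (((↑) : ℍ → ℂ) ⁻¹' s) = s :=
    Set.image_preimage_eq_iff.mpr fun z hz => ⟨⟨z, hpos z hz⟩, rfl⟩
  have hmp : MeasurePreserving ((↑) : ℍ → ℂ) (volume.comap ((↑) : ℍ → ℂ))
      (volume.restrict (Set.range ((↑) : ℍ → ℂ))) :=
    ⟨measurable_coe, measurableEmbedding_coe.map_comap _⟩
  have hdensity : Measurable fun z : ℍ => ((1 / NNReal.mk z.im z.im_pos.le : ℝ≥0) ^ 2) := by
    have : Continuous fun z : ℍ => NNReal.mk z.im z.im_pos.le := continuous_im.subtype_mk _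
    exact (measurable_const.div this.measurable).pow_const _
  have hcomap := hmp.setLIntegral_comp_emb measurableEmbedding_coe φ (((↑) : ℍ → ℂ) ⁻¹' s)
  rw [himg, Measure.restrict_restrict hs,
    Set.inter_eq_self_of_subset_left (Set.image_preimage_eq_iff.mp himg)] at hcomap
  rw [← hcomap, volume_def, setLIntegral_withDensity_eq_setLIntegral_mul_non_measurable _
    hdensity.coe_nnreal_ennreal _ (measurable_coe hs) (by simp)]
  refine lintegral_congr fun z => ?_
  have hz : ((1 / NNReal.mk z.im z.im_pos.le) ^ 2 : ℝ≥0) * Real.toNNReal (z.im ^ 2) = 1 := by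
    ext
    simp [z.im_ne_zero, sq_nonneg]
  rw [Pi.mul_apply, ← mul_assoc, ENNReal.ofReal, ← ENNReal.coe_mul, hz, ENNReal.coe_one, one_mul]

theorem norm_sub_conj_div_sq_mul_im (z w : ℍ) :
    ‖((z : ℂ) - conj (w : ℂ)) / (2 * Complex.I * w.im)‖ ^ 2 * w.im =
      Real.cosh (dist z w / 2) ^ 2 * z.im := by
  rw [cosh_half_dist, norm_div, ← dist_eq_norm, div_pow, div_pow, mul_pow,
    Real.sq_sqrt (mul_pos z.im_pos w.im_pos).le]
  have := z.im_ne_zero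
  have := w.im_ne_zero
  simp only [norm_mul, Complex.norm_ofNat, Complex.norm_I, mul_one, Complex.norm_real,
    Real.norm_eq_abs, abs_of_pos w.im_pos]
  field_simp

theorem abs_im_sub_le_half_of_mem_ball {n : ℕ} (hn : n ≠ 0) {z : ℂ} {w : ℍ}
    (hz : z ∈ Metric.ball (w : ℂ) (w.im / (2 * √n))) : |z.im - w.im| ≤ w.im / 2 :=
  calc |z.im - w.im| ≤ ‖z - w‖ := Complex.abs_im_le_norm (z - w)
    _ ≤ w.im / (2 * √n) := (mem_ball_iff_norm.mp hz).le
    _ ≤ w.im / 2 := by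
        have : 1 ≤ √(n : ℝ) :=
          Real.one_le_sqrt.mpr (by exact_mod_cast Nat.one_le_iff_ne_zero.mpr hn)
        gcongr
        linarith

theorem mul_dist_sq_le_half_of_coe_mem_ball {n : ℕ} (hn : n ≠ 0) {z w : ℍ}
    (hz : (z : ℂ) ∈ Metric.ball (w : ℂ) (w.im / (2 * √n))) : n * dist z w ^ 2 ≤ 1 / 2 := by
  have him : w.im / 2 ≤ z.im := by
    linarith [(abs_le.mp (abs_im_sub_le_half_of_mem_ball hn hz)).1, z.coe_im]
  have hn0 : (0 : ℝ) < n := by positivity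
  calc n * dist z w ^ 2 ≤ n * ((w.im / (2 * √n)) / √(w.im / 2 * w.im)) ^ 2 := by
        gcongr
        exact (dist_le_dist_coe_div_sqrt z w).trans (by gcongr; exact hz.le)
    _ = 1 / 2 := by
        rw [div_pow, div_pow, mul_pow, Real.sq_sqrt hn0.le, Real.sq_sqrt (by positivity)]
        field_simp

theorem cosh_pow_le_exp (x : ℝ) (n : ℕ) : Real.cosh x ^ n ≤ Real.exp (n * (x ^ 2 / 2)) := by
  rw [Real.exp_nat_mul]
  exact pow_le_pow_left₀ (Real.cosh_pos x).le (Real.cosh_le_exp_half_sq x) n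

theorem im_sq_mul_cosh_half_dist_pow_le {n : ℕ} (hn : n ≠ 0) {z w : ℍ}
    (hz : (z : ℂ) ∈ Metric.ball (w : ℂ) (w.im / (2 * √n))) :
    z.im ^ 2 * Real.cosh (dist z w / 2) ^ (2 * n) ≤ 3 * w.im ^ 2 := by
  have him : z.im ≤ 3 / 2 * w.im := by
    linarith [(abs_le.mp (abs_im_sub_le_half_of_mem_ball hn hz)).2, z.coe_im]
  have hdist := mul_dist_sq_le_half_of_coe_mem_ball hn hz
  have hcosh : Real.cosh (dist z w / 2) ^ (2 * n) ≤ 8 / 7 :=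
    calc Real.cosh (dist z w / 2) ^ (2 * n)
        ≤ Real.exp ((2 * n : ℕ) * ((dist z w / 2) ^ 2 / 2)) := cosh_pow_le_exp _ _
      _ ≤ Real.exp (1 / 8) := by
          gcongr
          push_cast
          linarith
      _ ≤ 8 / 7 := (Real.exp_bound_div_one_sub_of_interval' (by norm_num) (by norm_num)).le.trans
          (by norm_num)
  calc z.im ^ 2 * Real.cosh (dist z w / 2) ^ (2 * n) ≤ (3 / 2 * w.im) ^ 2 * (8 / 7) := by
        have := z.im_pos
        gcongr
    _ ≤ 3 * w.im ^ 2 := by nlinarith [sq_nonneg w.im]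

/-- The function `yⁿ f(z)`. If `f` is automorphic of weight `2n` for `Γ`, then its absolute value
is `Γ`-invariant, and the Petersson product is the `L²` product of such functions on `Γ \ ℍ`. -/
noncomputable def imPowMul (n : ℕ) (f : ℍ → ℂ) (z : ℍ) : ℂ := (z.im : ℂ) ^ n * f z

theorem imPowMul_sq (n : ℕ) (f : ℍ → ℂ) (z : ℍ) :
    imPowMul (2 * n) (f ^ 2) z = imPowMul n f z ^ 2 := by
  rw [imPowMul, imPowMul, Pi.pow_apply]
  ring

theorem continuous_imPowMul {f : ℍ → ℂ} (hf : Continuous f) (n : ℕ) :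
    Continuous (imPowMul n f) := by
  unfold imPowMul
  fun_prop

theorem norm_im_pow_mul_sub_conj_div_pow_mul (n : ℕ) (f : ℍ → ℂ) (z w : ℍ) :
    ‖(w.im : ℂ) ^ n * (((z : ℂ) - conj (w : ℂ)) / (2 * Complex.I * w.im)) ^ (2 * n) * f z‖ =
      Real.cosh (dist z w / 2) ^ (2 * n) * ‖imPowMul n f z‖ := by
  rw [imPowMul, norm_mul, norm_mul, norm_mul, norm_pow, norm_pow, norm_pow, pow_mul, pow_mul,
    ← mul_pow, mul_comm ‖(w.im : ℂ)‖, Complex.norm_of_nonneg w.im_pos.le,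
    Complex.norm_of_nonneg z.im_pos.le, norm_sub_conj_div_sq_mul_im, mul_pow, mul_assoc]

theorem enorm_imPowMul_mul_volume_ball_le {h : ℍ → ℂ} (hh : MDiff h) {n : ℕ} (hn : n ≠ 0) (w : ℍ) :
    ‖imPowMul n h w‖ₑ * volume (Metric.ball (w : ℂ) (w.im / (2 * √n))) ≤
      ENNReal.ofReal (3 * w.im ^ 2) * ∫⁻ z in Metric.closedBall w 1, ‖imPowMul n h z‖ₑ := by
  set B := Metric.ball (w : ℂ) (w.im / (2 * √n))
  let H : ℂ → ℂ := fun z =>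
    (w.im : ℂ) ^ n * ((z - conj (w : ℂ)) / (2 * Complex.I * w.im)) ^ (2 * n) * h (ofComplex z)
  have hH (z : ℍ) : ‖H z‖ = Real.cosh (dist z w / 2) ^ (2 * n) * ‖imPowMul n h z‖ := by
    simp only [H, ofComplex_apply, norm_im_pow_mul_sub_conj_div_pow_mul]
  have hpos : ∀ z ∈ B, 0 < z.im := fun z hz => by
    linarith [(abs_le.mp (abs_im_sub_le_half_of_mem_ball hn hz)).1, w.im_pos]
  have hHd : DifferentiableOn ℂ H B :=
    DifferentiableOn.mul (by fun_prop) ((UpperHalfPlane.mdifferentiable_iff.mp hh).mono hpos)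
  calc ‖imPowMul n h w‖ₑ * volume B = ‖H w‖ₑ * volume B := by
        rw [← ofReal_norm, ← ofReal_norm, hH, dist_self, zero_div, Real.cosh_zero, one_pow, one_mul]
    _ ≤ ∫⁻ z in B, ‖H z‖ₑ := enorm_mul_volume_ball_le_lintegral hHd
    _ = ∫⁻ z in ((↑) : ℍ → ℂ) ⁻¹' B, ENNReal.ofReal (z.im ^ 2) * ‖H z‖ₑ :=
        setLIntegral_eq_setLIntegral_preimage_coe _ measurableSet_ball hpos
    _ ≤ ∫⁻ z in ((↑) : ℍ → ℂ) ⁻¹' B, ENNReal.ofReal (3 * w.im ^ 2) * ‖imPowMul n h z‖ₑ := by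
        refine setLIntegral_mono' (measurable_coe measurableSet_ball) fun z hz => ?_
        rw [← ofReal_norm, ← ofReal_norm, hH, ← ENNReal.ofReal_mul (sq_nonneg _),
          ← ENNReal.ofReal_mul (by positivity), ← mul_assoc]
        gcongr ENNReal.ofReal (?_ * _)
        exact im_sq_mul_cosh_half_dist_pow_le hn hz
    _ ≤ ∫⁻ z in Metric.closedBall w 1, ENNReal.ofReal (3 * w.im ^ 2) * ‖imPowMul n h z‖ₑ := by
        refine lintegral_mono_set fun z hz => ?_
        have hn1 : (1 : ℝ) ≤ n := by exact_mod_cast Nat.one_le_iff_ne_zero.mpr hn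
        have hdist := mul_dist_sq_le_half_of_coe_mem_ball hn hz
        rw [Metric.mem_closedBall]
        nlinarith [sq_nonneg (dist z w - 1)]
    _ = _ := lintegral_const_mul' _ _ ENNReal.ofReal_ne_top

theorem volume_ball_div_two_mul_sqrt {n : ℕ} (hn : n ≠ 0) (c : ℂ) {y : ℝ} (hy : 0 ≤ y) :
    volume (Metric.ball c (y / (2 * √n))) * (4 * n) = ENNReal.ofReal (Real.pi * y ^ 2) := by
  have hn0 : (n : ℝ) ≠ 0 := by exact_mod_cast hn
  have hπ : (NNReal.pi : ℝ≥0∞) = ENNReal.ofReal Real.pi :=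
    (ENNReal.ofReal_coe_nnreal (p := NNReal.pi)).symm
  have hcast : (4 * n : ℝ≥0∞) = ENNReal.ofReal (4 * n) := by simp [ENNReal.ofReal_mul]
  rw [Complex.volume_ball, hπ, hcast, ← ENNReal.ofReal_pow (by positivity),
    ← ENNReal.ofReal_mul (by positivity), ← ENNReal.ofReal_mul (by positivity), div_pow,
    mul_pow, Real.sq_sqrt n.cast_nonneg]
  congr 1
  field_simp
  norm_num

theorem enorm_imPowMul_le_lintegral {h : ℍ → ℂ} (hh : MDiff h) {n : ℕ} (hn : n ≠ 0) (w : ℍ) :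
    ‖imPowMul n h w‖ₑ ≤ 4 * n * ∫⁻ z in Metric.closedBall w 1, ‖imPowMul n h z‖ₑ := by
  have hvol0 : volume (Metric.ball (w : ℂ) (w.im / (2 * √n))) ≠ 0 :=
    (Metric.measure_ball_pos _ _ (by positivity)).ne'
  refine (ENNReal.mul_le_mul_iff_left hvol0 measure_ball_lt_top.ne).mp ?_
  calc ‖imPowMul n h w‖ₑ * volume (Metric.ball (w : ℂ) (w.im / (2 * √n)))
      ≤ ENNReal.ofReal (3 * w.im ^ 2) * ∫⁻ z in Metric.closedBall w 1, ‖imPowMul n h z‖ₑ :=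
        enorm_imPowMul_mul_volume_ball_le hh hn w
    _ ≤ ENNReal.ofReal (Real.pi * w.im ^ 2) *
          ∫⁻ z in Metric.closedBall w 1, ‖imPowMul n h z‖ₑ := by
        gcongr
        exact Real.pi_gt_three.le
    _ = 4 * n * (∫⁻ z in Metric.closedBall w 1, ‖imPowMul n h z‖ₑ) *
          volume (Metric.ball (w : ℂ) (w.im / (2 * √n))) := by
        rw [← volume_ball_div_two_mul_sqrt hn w w.im_pos.le]
        ring

theorem enorm_imPowMul_sq_le_lintegral {f : ℍ → ℂ} (hf : MDiff f) {n : ℕ} (hn : n ≠ 0) (w : ℍ) :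
    ‖imPowMul n f w‖ₑ ^ 2 ≤ 8 * n * ∫⁻ z in Metric.closedBall w 1, ‖imPowMul n f z‖ₑ ^ 2 := by
  have := enorm_imPowMul_le_lintegral (hf.pow 2) (mul_ne_zero two_ne_zero hn) w
  simp only [imPowMul_sq, enorm_pow] at this
  convert this using 2
  push_cast
  ring

end LocalEstimate

section LinearCombination

variable {ι : Type*} {G : Subgroup (GL (Fin 2) ℝ)} [G.HasDetOne] {m : ℤ}

theorem imPowMul_sum_smul (n : ℕ) (f : ι → SlashInvariantForm G m) (t : Finset ι) (a : ι → ℂ)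
    (z : ℍ) : imPowMul n (∑ j ∈ t, a j • f j : SlashInvariantForm G m) z =
      ∑ j ∈ t, a j * imPowMul n (f j) z := by
  simp [imPowMul, Finset.mul_sum, mul_left_comm]

theorem mdifferentiable_sum_smul {f : ι → SlashInvariantForm G m} (hf : ∀ j, MDiff (f j))
    (t : Finset ι) (a : ι → ℂ) : MDiff (∑ j ∈ t, a j • f j : SlashInvariantForm G m) :=
  Finset.sum_induction _ (fun g : SlashInvariantForm G m => MDiff g) (fun _ _ => .add)
    mdifferentiable_const fun j _ => (hf j).const_smul (a j)

end LinearCombination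

section Automorphic

variable {Γ : Subgroup PSL(2, ℝ)} {k : ℕ}

theorem enorm_imPowMul_smul (f : SlashInvariantForm (matrixGroup Γ) (2 * k)) (γ : Γ) (z : ℍ) :
    ‖imPowMul k f (γ • z)‖ₑ = ‖imPowMul k f z‖ₑ := by
  have hsq (w : ℍ) : ‖petersson (2 * (k : ℤ)) f f w‖ = ‖imPowMul k f w‖ ^ 2 := by
    rw [petersson, imPowMul, zpow_mul, zpow_natCast]
    simp only [zpow_ofNat, norm_mul, norm_pow, RCLike.norm_conj]
    ring
  obtain ⟨g, hg⟩ := exists_representative Γ γ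
  have hsmul : (Matrix.SpecialLinearGroup.mapGL ℝ (g : SL(2, ℝ)) : GL (Fin 2) ℝ) • z = γ • z := by
    rw [Subgroup.smul_def, ← hg, mk_smul]
    rfl
  have := SlashInvariantFormClass.norm_petersson_smul (k := 2 * (k : ℤ)) (f := f) (f' := f)
    (τ := z) (Subgroup.mem_map_of_mem (Matrix.SpecialLinearGroup.mapGL ℝ) g.2)
  rwa [hsmul, hsq, hsq, sq_eq_sq₀ (norm_nonneg _) (norm_nonneg _), ← enorm_eq_iff_norm_eq] at this

theorem exists_enorm_imPowMul_sq_le_lintegral [DiscreteTopology Γ] {D A : Set ℍ}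
    (hD : IsFundamentalDomain Γ D volume) (hA : IsCompact A) :
    ∃ N : ℕ, ∀ k : ℕ, 0 < k → ∀ f : SlashInvariantForm (matrixGroup Γ) (2 * k), MDiff f →
      ∀ w ∈ A, ‖imPowMul k f w‖ₑ ^ 2 ≤ N * k * ∫⁻ z in D, ‖imPowMul k f z‖ₑ ^ 2 := by
  have := countable_of_discrete Γ
  obtain ⟨N, hN⟩ := exists_setLIntegral_le_fundamentalDomain hD (hA.cthickening (r := 1))
  refine ⟨8 * N, fun k hk f hf w hw => ?_⟩
  have hcont : Continuous (imPowMul k f) := continuous_imPowMul hf.continuous k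
  calc ‖imPowMul k f w‖ₑ ^ 2
      ≤ 8 * k * ∫⁻ z in Metric.closedBall w 1, ‖imPowMul k f z‖ₑ ^ 2 :=
        enorm_imPowMul_sq_le_lintegral hf hk.ne' w
    _ ≤ 8 * k * ∫⁻ z in Metric.cthickening 1 A, ‖imPowMul k f z‖ₑ ^ 2 := by
        gcongr
        exact Metric.closedBall_subset_cthickening hw 1
    _ ≤ 8 * k * (N * ∫⁻ z in D, ‖imPowMul k f z‖ₑ ^ 2) := by
        gcongr
        refine hN _ (hcont.enorm.measurable.pow_const 2).aemeasurable fun γ z => ?_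
        rw [enorm_imPowMul_smul]
    _ = (8 * N : ℕ) * k * ∫⁻ z in D, ‖imPowMul k f z‖ₑ ^ 2 := by
        push_cast
        ring

theorem sumSq_mk {ι : Type*} (f : ι → CuspForms Γ k) (z : ℍ) :
    sumSq f (Quotient.mk _ z) = ∑' j, ‖imPowMul k (f j) z‖ₑ ^ 2 := by
  refine tsum_congr fun j => ?_
  rw [← ofReal_norm, ← ENNReal.ofReal_pow (norm_nonneg _)]
  simp [imPowMul, mul_pow, abs_of_pos z.im_pos, ← pow_mul, mul_comm]

end Automorphic

section Petersson

variable {Γ : Subgroup PSL(2, ℝ)} [DiscreteTopology Γ] {k : ℕ}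

theorem SquareIntegrable.memLp {f : CuspForms Γ k} (hf : SquareIntegrable f) :
    MemLp (imPowMul k f) 2 (volume.restrict (fundamentalDomain Γ)) := by
  have hcont := continuous_imPowMul (CuspFormClass.holo f).continuous k
  rw [memLp_two_iff_integrable_sq_norm hcont.aestronglyMeasurable]
  refine hf.congr (ae_of_all _ fun z => ?_)
  simp [imPowMul, mul_pow, abs_of_pos z.im_pos, ← pow_mul, mul_comm]

theorem inner_toLp_eq_peterssonInner {f g : CuspForms Γ k} (hf : SquareIntegrable f)
    (hg : SquareIntegrable g) : inner ℂ hf.memLp.toLp hg.memLp.toLp = peterssonInner g f := by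
  rw [L2.inner_def, peterssonInner]
  refine integral_congr_ae ?_
  filter_upwards [hf.memLp.coeFn_toLp, hg.memLp.coeFn_toLp] with z hfz hgz
  rw [hfz, hgz]
  simp only [imPowMul, RCLike.inner_apply, map_mul, map_pow, Complex.conj_ofReal]
  ring

theorem IsOrthonormalBasis.orthonormal {ι : Type*} {f : ι → CuspForms Γ k}
    (hf : IsOrthonormalBasis f) : Orthonormal ℂ fun j => (hf.squareIntegrable j).memLp.toLp := by
  classical
  refine orthonormal_iff_ite.mpr fun i j => ?_
  rw [inner_toLp_eq_peterssonInner (hf.squareIntegrable i) (hf.squareIntegrable j)]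
  split_ifs with h
  · rw [h, hf.inner_self]
  · exact hf.inner_of_ne j i (Ne.symm h)

end Petersson

end Fuchsian

open Fuchsian in
theorem theorem4p2_general {Γ : Subgroup PSL(2, ℝ)} [DiscreteTopology Γ] {D : Set ℍ}
    (hD : IsFundamentalDomain Γ D volume) {K : Set (QuotientSpace Γ)} (hK : IsCompact K) :
    ∃ C : ℝ≥0, ∀ k : ℕ, 0 < k →
      ∀ (ι : Type*) (f : ι → SlashInvariantForm (matrixGroup Γ) (2 * k)), (∀ j, MDiff (f j)) →
        ∀ hL : ∀ j, MemLp (imPowMul k (f j)) 2 (volume.restrict D),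
          Orthonormal ℂ (fun j => (hL j).toLp) →
            ∀ z : ℍ, Quotient.mk _ z ∈ K → ∑' j, ‖imPowMul k (f j) z‖ₑ ^ 2 ≤ C * k := by
  obtain ⟨A, hA, hKA⟩ := exists_isCompact_subset_image
    (MulAction.isOpenQuotientMap_quotientMk (Γ := Γ) (T := ℍ)) hK
  obtain ⟨N, hN⟩ := exists_enorm_imPowMul_sq_le_lintegral hD hA
  refine ⟨N, fun k hk ι f hf hL horth z hz => ?_⟩
  obtain ⟨w, hwA, hwz⟩ := hKA hz
  obtain ⟨γ, rfl⟩ := Quotient.exact hwz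
  simp_rw [← enorm_imPowMul_smul _ γ z]
  refine tsum_enorm_sq_le_of_orthonormal hL horth fun t a => ?_
  simpa only [imPowMul_sum_smul, ENNReal.coe_natCast] using
    hN k hk _ (mdifferentiable_sum_smul hf t a) (γ • z) hwA

theorem theorem4p2 (Γ : Subgroup PSL(2, ℝ)) [DiscreteTopology Γ]
    (K : Set (Fuchsian.QuotientSpace Γ)) (hK : IsCompact K) :
    ∃ C : ℝ≥0, ∀ k : ℕ, 0 < k → ∀ (ι : Type*) (f : ι → Fuchsian.CuspForms Γ k),
      Fuchsian.IsOrthonormalBasis f → (⨆ z ∈ K, Fuchsian.sumSq f z) ≤ C * k := by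
  obtain ⟨C, hC⟩ := theorem4p2_general (Fuchsian.isFundamentalDomain Γ) hK
  refine ⟨C, fun k hk ι f hf => iSup₂_le ?_⟩
  rintro ⟨z⟩ hz
  exact (Fuchsian.sumSq_mk f z).trans_le <| hC k hk ι (fun j => (f j).toSlashInvariantForm)
    (fun j => (f j).holo') _ hf.orthonormal z hz
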